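/- Let $E$ be a finite or countable set, let $\ell^2(E)$ be the real or complex Hilbert space with standard orthonormal basis $(\mathbf{1}_e)_{e\in E}$, and let $H\subseteq \ell^2(E)$ be a closed subspace with orthogonal projection $P_H$. For $B\subseteq E$ let $[B]$ be the closed linear span of $\{\mathbf{1}_e : e\in B\}$, with orthogonal projection $P_{[B]}$, and let $H_B:=\overline{P_{[B]}H}$. There is a unique probability measure $\mathbf{P}^H$ on the subsets of $E$ (with the product $\sigma$-field) such that a random set $S$ with law $\mathbf{P}^H$ satisfies $$\mathbf{P}^H[A\subseteq S]=\det\big[\langle P_H \mathbf{1}_e,\mathbf{1}_f\rangle\big]_{e,f\in A}\qquad\text{for every finite } A\subseteq E ,$$ and for this measure $$H_S=[S]\qquad \mathbf{P}^H\text{-almost surely.}$$ -/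

import Mathlib

open MeasureTheory

noncomputable section

namespace Determinantal

variable {𝕜 : Type*} [RCLike 𝕜] {E : Type*}

/-- The Hilbert space `ℓ²(E)` over the scalar field `𝕜` (which is `ℝ` or `ℂ`). -/
abbrev ell2 (𝕜 : Type*) [RCLike 𝕜] (E : Type*) : Type _ := lp (fun _ : E => 𝕜) 2

variable [DecidableEq E]

/-- The element `e` of `E`, seen as a vector of the standard orthonormal basis of `ℓ²(E)`. -/
def basisVec (𝕜 : Type*) [RCLike 𝕜] (e : E) : ell2 𝕜 E := lp.single 2 e (1 : 𝕜)

/-- `[B]`, the closed linear span of the basis vectors `e ∈ B`. -/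
def bracket (𝕜 : Type*) [RCLike 𝕜] (B : Set E) : Submodule 𝕜 (ell2 𝕜 E) :=
  (Submodule.span 𝕜 (basisVec 𝕜 '' B)).topologicalClosure

instance (B : Set E) : CompleteSpace (bracket 𝕜 B) :=
  inferInstanceAs
    (CompleteSpace (Submodule.span 𝕜 (basisVec 𝕜 '' B)).topologicalClosure)

/-- `H_B`, the closure of the image of `H` under the orthogonal projection onto `[B]`. -/
def restrictTo (H : Submodule 𝕜 (ell2 𝕜 E)) (B : Set E) : Submodule 𝕜 (ell2 𝕜 E) :=
  (H.map ((bracket 𝕜 B).starProjection : ell2 𝕜 E →ₗ[𝕜] ell2 𝕜 E)).topologicalClosure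

/-- The matrix of the orthogonal projection `P_H` in the standard basis of `ℓ²(E)`. -/
def projMatrix (H : ClosedSubmodule 𝕜 (ell2 𝕜 E)) : Matrix E E 𝕜 :=
  Matrix.of fun e f => inner 𝕜 (basisVec 𝕜 e) (H.toSubmodule.starProjection (basisVec 𝕜 f))

/-- `μ` is the law of a random subset `S` of `E` such that
`P[A ⊆ S] = det (Q ↾ A)` for all finite `A ⊆ E`. -/
structure IsDeterminantal (Q : Matrix E E 𝕜) (μ : Measure (Set E)) : Prop where
  isProbabilityMeasure : IsProbabilityMeasure μ
  measure_superset : ∀ A : Finset E,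
    ((μ.real {S : Set E | (A : Set E) ⊆ S} : ℝ) : 𝕜) =
      (Q.submatrix (fun e : A => (e : E)) (fun e : A => (e : E))).det

end Determinantal

end

/-! Existence: for finite `A`, the mixed determinants `(rowMix Q B Bᶜ).det` should be the
probabilities that `S ∩ A = B`. They are nonnegative because `0 ≤ Q ≤ 1` (`det_rowMix_compl_nonneg`)
and multilinearity gives the right sums, so each `A` carries a law; compactness of the probability
measures on `E → Bool` yields a global one.

Almost sure statement: `H_S = [S]` as soon as `Hᗮ ∩ [S] = 0`. Let `w` lie in this intersection with
nonzero coordinate `w_e`. By `norm_sq_mul_det_le`, the conditional probability that `e ∈ S`, given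
the trace of `S` on `A \ {e}`, is at most `‖w - w|_A‖² / |w_e|²`, which tends to `0` as `A` grows.
But containing an element of conditional probability at most `δ` is an event of probability at most
`δ` (`measure_improbable_le`). Letting `δ → 0`, such a `w` exists with probability `0`, for each of
the countably many `e`. -/

namespace Determinantal

/-! ### Multilinear identities for mixed determinants -/

section Matrices

variable {𝕜 : Type*} {n : Type*} [Fintype n] [DecidableEq n]

/-- The matrix whose rows are those of `Q` over `B`, those of `1 - Q` over `C`, and those of the
identity elsewhere. -/
def rowMix [Ring 𝕜] (Q : Matrix n n 𝕜) (B C : Finset n) : Matrix n n 𝕜 :=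
  Matrix.of fun i => if i ∈ B then Q i else if i ∈ C then (1 - Q) i else (1 : Matrix n n 𝕜) i

theorem det_rowMix_add_det_rowMix [CommRing 𝕜] (Q : Matrix n n 𝕜) {B C : Finset n} {f : n}
    (hB : f ∉ B) (hC : f ∉ C) :
    (rowMix Q (insert f B) C).det + (rowMix Q B (insert f C)).det = (rowMix Q B C).det := by
  have h1 : rowMix Q (insert f B) C = (rowMix Q B C).updateRow f (Q f) := by
    ext i j
    by_cases h : i = f
    · subst h; simp [rowMix]
    · simp [rowMix, h]
  have h2 : rowMix Q B (insert f C) = (rowMix Q B C).updateRow f ((1 - Q) f) := by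
    ext i j
    by_cases h : i = f
    · subst h; simp [rowMix, hB]
    · simp [rowMix, h]
  have h3 : rowMix Q B C = (rowMix Q B C).updateRow f (Q f + (1 - Q) f) := by
    ext i j
    by_cases h : i = f
    · subst h; simp [rowMix, hB, hC]
    · simp [h]
  rw [h1, h2]
  conv_rhs => rw [h3]
  rw [Matrix.det_updateRow_add]

theorem det_rowMix_empty [CommRing 𝕜] (Q : Matrix n n 𝕜) (B : Finset n) :
    (rowMix Q B ∅).det = (Q.submatrix (fun i : B => (i : n)) (fun i : B => (i : n))).det := by
  rw [Matrix.twoBlockTriangular_det (rowMix Q B ∅) (fun i => i ∈ B)]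
  · have h2 : ((rowMix Q B ∅).toSquareBlockProp fun i => ¬ i ∈ B) = 1 := by
      ext i j
      simp [rowMix, Matrix.toSquareBlockProp, i.2, Matrix.one_apply, Subtype.ext_iff]
    have h3 : ((rowMix Q B ∅).toSquareBlockProp fun i => i ∈ B) =
        Q.submatrix (fun i : B => (i : n)) (fun i : B => (i : n)) := by
      ext i j
      change rowMix Q B ∅ i j = Q i j
      rw [rowMix, Matrix.of_apply, if_pos i.2]
    rw [h2, Matrix.det_one, mul_one, h3]
    congr!
  · intro i hi j hj
    have : i ≠ j := by rintro rfl; exact hi hj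
    simp [rowMix, hi, this]

/-- Expand each row as `Q i + (1 - Q) i` outside `X` and as `Q i + 0` inside: the zero rows kill
every term in which `B` misses a point of `X`. -/
theorem det_rowMix_empty_eq_sum [CommRing 𝕜] (Q : Matrix n n 𝕜) (X : Finset n) :
    (rowMix Q X ∅).det = ∑ B : Finset n, if X ⊆ B then (rowMix Q B Bᶜ).det else 0 := by
  have h := (Matrix.detRowAlternating (R := 𝕜) (n := n)).toMultilinearMap.map_add_univ
    (fun i => Q i) (fun i => if i ∈ X then 0 else (1 - Q) i)
  have h0 : ((fun i => Q i) + fun i => if i ∈ X then 0 else (1 - Q) i) = rowMix Q X ∅ := by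
    ext i j
    by_cases hi : i ∈ X <;> simp [rowMix, hi]
  rw [h0] at h
  refine h.trans (Finset.sum_congr rfl fun B _ => ?_)
  split_ifs with hX
  · change Matrix.det _ = _
    congr 1
    ext i j
    by_cases hi : i ∈ B
    · simp [rowMix, hi]
    · have : i ∉ X := fun h => hi (hX h)
      simp [rowMix, hi, this]
  · obtain ⟨i, hi, hi'⟩ := Finset.not_subset.1 hX
    change Matrix.det _ = _
    refine Matrix.det_eq_zero_of_row_eq_zero i fun j => ?_
    simp [hi, hi']

end Matrices

/-! ### Nonnegativity of the mixed determinants -/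

section Positivity

open scoped ComplexOrder Matrix

variable {𝕜 : Type*} [RCLike 𝕜] {n : Type*} [Fintype n] [DecidableEq n]

/-- Factoring `Q` out on the right leaves a principal minor of `Q⁻¹ - 1`, which is positive
semidefinite since `Q ≤ 1`. -/
theorem det_rowMix_compl_nonneg_of_posDef {Q : Matrix n n 𝕜} (hQ : Q.PosDef)
    (hQ1 : (1 - Q).PosSemidef) (B : Finset n) : 0 ≤ (rowMix Q B Bᶜ).det := by
  have hu : IsUnit Q.det := hQ.det_pos.ne'.isUnit
  have hinv : Q⁻¹ * Q = 1 := Matrix.nonsing_inv_mul _ hu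
  have hinv' : Q * Q⁻¹ = 1 := Matrix.mul_nonsing_inv _ hu
  have h1 : (Q⁻¹ - 1).PosSemidef := by
    have e : Q⁻¹ - 1 = (1 - Q) + (1 - Q) * Q⁻¹ * (1 - Q)ᴴ := by
      rw [hQ1.isHermitian.eq]
      have : (1 - Q) * Q⁻¹ * (1 - Q) = Q⁻¹ - Q⁻¹ * Q - Q * Q⁻¹ + Q * (Q⁻¹ * Q) := by
        noncomm_ring
      rw [this, hinv, hinv', mul_one]
      abel
    rw [e]
    exact hQ1.add (hQ.inv.posSemidef.mul_mul_conjTranspose_same _)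
  have h2 : rowMix Q B Bᶜ = rowMix (Q⁻¹ - 1) Bᶜ ∅ * Q := by
    have hq' : 1 - Q = (Q⁻¹ - 1) * Q := by rw [sub_mul, hinv, one_mul]
    ext i j
    by_cases hi : i ∈ B
    · rw [Matrix.mul_apply]
      simp [rowMix, hi, Matrix.one_apply]
    · have : ((Q⁻¹ - 1) * Q) i j = (1 - Q) i j := by rw [hq']
      rw [Matrix.mul_apply] at this ⊢
      simpa [rowMix, hi] using this.symm
  rw [h2, Matrix.det_mul, det_rowMix_empty]
  exact mul_nonneg (h1.submatrix _).det_nonneg hQ.det_pos.le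

theorem det_rowMix_compl_nonneg {Q : Matrix n n 𝕜} (hQ : Q.PosSemidef)
    (hQ1 : (1 - Q).PosSemidef) (B : Finset n) : 0 ≤ (rowMix Q B Bᶜ).det := by
  -- Moving `Q` towards `1` makes it positive definite and keeps `1 - R ε = (1 - ε)(1 - Q)` positive
  -- semidefinite; then `ε → 0⁺`.
  let R : ℝ → Matrix n n 𝕜 := fun ε => ((1 - ε : ℝ) : 𝕜) • Q + ((ε : ℝ) : 𝕜) • 1
  have hR : Continuous R := by
    have h1 : Continuous fun ε : ℝ => ((1 - ε : ℝ) : 𝕜) :=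
      RCLike.continuous_ofReal.comp (by fun_prop)
    have h2 : Continuous fun ε : ℝ => (ε : 𝕜) := RCLike.continuous_ofReal
    fun_prop
  have hcont : Continuous fun ε => (rowMix (R ε) B Bᶜ).det := by
    refine Continuous.matrix_det (continuous_matrix fun i j => ?_)
    have hij : Continuous fun ε => R ε i j := hR.matrix_elem i j
    by_cases hi : i ∈ B
    · simpa [rowMix, hi] using hij
    · have : Continuous fun ε => (1 : Matrix n n 𝕜) i j - R ε i j := by fun_prop
      simpa [rowMix, hi] using this
  have hlim : Filter.Tendsto (fun ε => (rowMix (R ε) B Bᶜ).det) (nhdsWithin 0 (Set.Ioi 0))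
      (nhds (rowMix Q B Bᶜ).det) := by
    have := (hcont.tendsto 0).mono_left (nhdsWithin_le_nhds (s := Set.Ioi 0))
    simpa [R] using this
  refine ge_of_tendsto hlim ?_
  filter_upwards [Ioo_mem_nhdsGT (zero_lt_one' ℝ)] with ε hε
  have h0 : (0 : 𝕜) ≤ ((1 - ε : ℝ) : 𝕜) := by
    rw [RCLike.ofReal_nonneg]; linarith [hε.2]
  have h1 : (0 : 𝕜) < ((ε : ℝ) : 𝕜) := RCLike.ofReal_pos.2 hε.1
  refine det_rowMix_compl_nonneg_of_posDef ?_ ?_ B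
  · exact Matrix.PosDef.posSemidef_add (hQ.smul h0) (Matrix.PosDef.one.smul h1)
  · have : 1 - R ε = ((1 - ε : ℝ) : 𝕜) • (1 - Q) := by
      ext i j
      simp only [R, Matrix.sub_apply, Matrix.add_apply, Matrix.smul_apply, smul_eq_mul]
      push_cast
      ring
    rw [this]
    exact hQ1.smul h0

end Positivity

/-! ### Uniqueness, pattern probabilities and existence of the law -/

section Law

variable {𝕜 : Type*} [RCLike 𝕜] {E : Type*}

theorem measurableSet_superset (A : Finset E) : MeasurableSet {S : Set E | (A : Set E) ⊆ S} := by
  have : {S : Set E | (A : Set E) ⊆ S} = ⋂ a ∈ A, {S : Set E | a ∈ S} := by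
    ext S; simp [Set.subset_def]
  rw [this]
  exact Finset.measurableSet_biInter _ fun a _ => measurableSet_mem a

/-- The sets of subsets of `E` which contain `B` and are disjoint from `C`, for `B` and `C`
included in `A`. -/
def pattern (A : Finset E) (B C : Finset A) : Set (Set E) :=
  {S | (∀ i ∈ B, (i : E) ∈ S) ∧ ∀ i ∈ C, (i : E) ∉ S}

theorem measurableSet_pattern (A : Finset E) (B C : Finset A) :
    MeasurableSet (pattern A B C) := by
  have : pattern A B C =
      (⋂ i ∈ B, {S : Set E | (i : E) ∈ S}) ∩ ⋂ i ∈ C, {S : Set E | (i : E) ∉ S} := by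
    ext S; simp [pattern]
  rw [this]
  exact (Finset.measurableSet_biInter _ fun a _ => measurableSet_mem _).inter
    (Finset.measurableSet_biInter _ fun a _ => measurableSet_notMem _)

variable [DecidableEq E]

/-- The events `A ⊆ S` form a π-system generating the product σ-field. -/
theorem IsDeterminantal.unique {Q : Matrix E E 𝕜} {μ ν : Measure (Set E)}
    (hμ : IsDeterminantal Q μ) (hν : IsDeterminantal Q ν) : μ = ν := by
  have := hμ.isProbabilityMeasure
  have := hν.isProbabilityMeasure
  refine ext_of_generate_finite (Set.range fun A : Finset E => {S : Set E | (A : Set E) ⊆ S})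
    (le_antisymm ?_ ?_) ?_ ?_ (by simp)
  · let m := MeasurableSpace.generateFrom
      (Set.range fun A : Finset E => {S : Set E | (A : Set E) ⊆ S})
    have hid : @Measurable (Set E) (Set E) m Set.instMeasurableSpace id := by
      refine (@measurable_set_iff _ _ m _).2 fun a => @measurable_to_prop _ m _ ?_
      refine MeasurableSpace.measurableSet_generateFrom ⟨{a}, ?_⟩
      ext S
      simp
    exact fun s hs => hid hs
  · refine MeasurableSpace.generateFrom_le ?_
    rintro _ ⟨A, rfl⟩
    exact measurableSet_superset A
  · rintro _ ⟨A, rfl⟩ _ ⟨B, rfl⟩ -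
    refine ⟨A ∪ B, ?_⟩
    ext S
    simp
  · rintro _ ⟨A, rfl⟩
    have h := (hμ.measure_superset A).trans (hν.measure_superset A).symm
    rw [RCLike.ofReal_inj] at h
    exact (measureReal_eq_measureReal_iff).1 h

/-- Inclusion–exclusion one excluded point at a time: both sides satisfy the same additive recursion
in `C`. -/
theorem IsDeterminantal.measureReal_pattern {Q : Matrix E E 𝕜} {μ : Measure (Set E)}
    (hμ : IsDeterminantal Q μ) (A : Finset E) (B C : Finset A) (hBC : Disjoint B C) :
    ((μ.real (pattern A B C) : ℝ) : 𝕜) =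
      (rowMix (Q.submatrix (fun i : A => (i : E)) (fun i : A => (i : E))) B C).det := by
  have := hμ.isProbabilityMeasure
  induction C using Finset.induction_on generalizing B with
  | empty =>
    rw [det_rowMix_empty]
    have h := hμ.measure_superset (B.map (Function.Embedding.subtype _))
    have hs : {S : Set E | ((B.map (Function.Embedding.subtype _) : Finset E) : Set E) ⊆ S} =
        pattern A B ∅ := by
      ext S
      simp [pattern, Set.subset_def]
    rw [hs] at h
    rw [h, ← Matrix.det_submatrix_equiv_self (B.equivMap (Function.Embedding.subtype _))]
    rfl
  | insert f C hf ih =>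
    rw [Finset.disjoint_insert_right] at hBC
    have h1 := ih B hBC.2
    have h2 := ih (insert f B) (Finset.disjoint_insert_left.2 ⟨hf, hBC.2⟩)
    have h3 := det_rowMix_add_det_rowMix
      (Q.submatrix (fun i : A => (i : E)) (fun i : A => (i : E))) hBC.1 hf
    have hu : pattern A B C = pattern A (insert f B) C ∪ pattern A B (insert f C) := by
      ext S
      simp only [pattern, Finset.mem_insert, forall_eq_or_imp, Set.mem_union, Set.mem_ofPred_eq]
      tauto
    have hd : Disjoint (pattern A (insert f B) C) (pattern A B (insert f C)) := by
      rw [Set.disjoint_left]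
      intro S h h'
      exact h'.2 f (Finset.mem_insert_self _ _) (h.1 f (Finset.mem_insert_self _ _))
    have hm := measureReal_union (μ := μ) hd (measurableSet_pattern A B (insert f C))
    rw [← hu] at hm
    rw [← h1, ← h2, hm] at h3
    push_cast at h3
    exact (add_left_cancel h3).symm

open scoped ComplexOrder in
/-- A finitely supported law with the prescribed probabilities for the subsets of `A`. -/
theorem exists_probabilityMeasure_of_finset {Q : Matrix E E 𝕜} (A : Finset E)
    (hQ : (Q.submatrix (fun i : A => (i : E)) (fun i : A => (i : E))).PosSemidef)
    (hQ1 : (1 - Q.submatrix (fun i : A => (i : E)) (fun i : A => (i : E))).PosSemidef) :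
    ∃ μ : ProbabilityMeasure (E → Bool), ∀ X ⊆ A,
      (((μ : Measure (E → Bool)).real {s | ∀ e ∈ X, s e = true} : ℝ) : 𝕜) =
        (Q.submatrix (fun e : X => (e : E)) (fun e : X => (e : E))).det := by
  set QA := Q.submatrix (fun i : A => (i : E)) (fun i : A => (i : E)) with hQA
  let c : Finset A → ℝ := fun B => RCLike.re (rowMix QA B Bᶜ).det
  have hc : ∀ B, 0 ≤ c B := fun B =>
    (RCLike.nonneg_iff.1 (det_rowMix_compl_nonneg hQ hQ1 B)).1
  have hc' : ∀ B, ((c B : ℝ) : 𝕜) = (rowMix QA B Bᶜ).det := fun B =>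
    RCLike.conj_eq_iff_re.1
      (RCLike.conj_eq_iff_im.2 (RCLike.nonneg_iff.1 (det_rowMix_compl_nonneg hQ hQ1 B)).2)
  let s : Finset A → E → Bool := fun B e => decide (∃ h : e ∈ A, (⟨e, h⟩ : A) ∈ B)
  let m : Measure (E → Bool) := ∑ B : Finset A, ENNReal.ofReal (c B) • Measure.dirac (s B)
  have hm : ∀ (X : Finset A) (Z : Set (E → Bool)), MeasurableSet Z →
      (∀ B, s B ∈ Z ↔ X ⊆ B) → m.real Z = ∑ B : Finset A, if X ⊆ B then c B else 0 := by
    intro X Z hZ hZX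
    have : m Z = ∑ B : Finset A, ENNReal.ofReal (if X ⊆ B then c B else 0) := by
      simp only [m, Measure.coe_finsetSum, Finset.sum_apply, Measure.smul_apply,
        Measure.dirac_apply' _ hZ, smul_eq_mul]
      refine Finset.sum_congr rfl fun B _ => ?_
      by_cases h : X ⊆ B
      · simp [Set.indicator, hZX, h]
      · simp [Set.indicator, hZX, h]
    rw [Measure.real, this, ← ENNReal.ofReal_sum_of_nonneg, ENNReal.toReal_ofReal]
    · exact Finset.sum_nonneg fun B _ => by split_ifs <;> simp [hc]
    · exact fun B _ => by split_ifs <;> simp [hc]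
  have hmdet : ∀ (X : Finset A) (Z : Set (E → Bool)), MeasurableSet Z →
      (∀ B, s B ∈ Z ↔ X ⊆ B) → ((m.real Z : ℝ) : 𝕜) = (rowMix QA X ∅).det := by
    intro X Z hZ hZX
    rw [hm X Z hZ hZX, det_rowMix_empty_eq_sum]
    push_cast
    refine Finset.sum_congr rfl fun B _ => ?_
    split_ifs <;> simp [hc']
  have hprob : IsProbabilityMeasure m := by
    have h := hmdet ∅ Set.univ MeasurableSet.univ (by simp)
    have h1 : (rowMix QA ∅ ∅) = 1 := by ext i j; simp [rowMix]
    rw [h1, Matrix.det_one, ← RCLike.ofReal_one, RCLike.ofReal_inj] at h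
    refine ⟨?_⟩
    rw [Measure.real, ENNReal.toReal_eq_one_iff] at h
    exact h
  refine ⟨⟨m, hprob⟩, fun X hX => ?_⟩
  have hX' : ((X.subtype (· ∈ A)).map (Function.Embedding.subtype _)) = X := by
    rw [Finset.subtype_map, Finset.filter_true_of_mem hX]
  have hZ : MeasurableSet {s : E → Bool | ∀ e ∈ X, s e = true} := by
    have : {s : E → Bool | ∀ e ∈ X, s e = true} = ⋂ e ∈ X, (fun s => s e) ⁻¹' {true} := by
      ext; simp
    rw [this]
    exact Finset.measurableSet_biInter _ fun e _ => measurable_pi_apply e (measurableSet_singleton _)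
  refine (hmdet (X.subtype (· ∈ A)) _ hZ fun B => ?_).trans ?_
  · simp only [s, Set.mem_ofPred_eq, decide_eq_true_eq, Finset.subset_iff, Finset.mem_subtype]
    exact ⟨fun h i hi => (h i hi).2, fun h e he => ⟨hX he, h (x := ⟨e, hX he⟩) he⟩⟩
  · rw [det_rowMix_empty]
    let φ : X ≃ (X.subtype (· ∈ A) : Finset A) :=
      { toFun := fun e => ⟨⟨e, hX e.2⟩, Finset.mem_subtype.2 e.2⟩
        invFun := fun i => ⟨i, Finset.mem_subtype.1 i.2⟩
        left_inv := fun e => rfl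
        right_inv := fun i => rfl }
    rw [← Matrix.det_submatrix_equiv_self φ]
    rfl

-- A weak limit of the finite laws along an ultrafilter finer than `atTop`; no projective
-- consistency is needed, since each determinant is eventually attained exactly.
open scoped ComplexOrder in
theorem exists_isDeterminantal [Countable E] {Q : Matrix E E 𝕜}
    (hQ : ∀ A : Finset E,
      (Q.submatrix (fun i : A => (i : E)) (fun i : A => (i : E))).PosSemidef)
    (hQ1 : ∀ A : Finset E,
      (1 - Q.submatrix (fun i : A => (i : E)) (fun i : A => (i : E))).PosSemidef) :
    ∃ μ : Measure (Set E), IsDeterminantal Q μ := by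
  choose m hm using fun A => exists_probabilityMeasure_of_finset A (hQ A) (hQ1 A)
  let F : Ultrafilter (Finset E) := Ultrafilter.of Filter.atTop
  have hF : (F : Filter (Finset E)) ≤ Filter.atTop := Ultrafilter.of_le _
  obtain ⟨ν, -, hν⟩ := isCompact_univ.ultrafilter_le_nhds (F.map m) (by simp)
  have hν' : Filter.Tendsto m F (nhds ν) := hν
  have hlim : ∀ X : Finset E,
      (((ν : Measure (E → Bool)).real {s | ∀ e ∈ X, s e = true} : ℝ) : 𝕜) =
        (Q.submatrix (fun e : X => (e : E)) (fun e : X => (e : E))).det := by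
    intro X
    -- Clopen cylinders have empty frontier, so weak convergence preserves their probabilities.
    have hclopen : IsClopen {s : E → Bool | ∀ e ∈ X, s e = true} := by
      have : {s : E → Bool | ∀ e ∈ X, s e = true} = ⋂ e ∈ X, (fun s => s e) ⁻¹' {true} := by
        ext; simp
      rw [this]
      exact isClopen_biInter_finset fun e _ => (isClopen_discrete _).preimage (continuous_apply e)
    have h1 := ProbabilityMeasure.tendsto_measure_of_null_frontier_of_tendsto' hν'
      (E := {s : E → Bool | ∀ e ∈ X, s e = true}) (by simp [hclopen.frontier_eq])
    have h2 := (ENNReal.tendsto_toReal (measure_ne_top _ _)).comp h1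
    have h3 := (RCLike.continuous_ofReal (K := 𝕜)).tendsto _ |>.comp h2
    refine tendsto_nhds_unique_of_eventuallyEq h3 tendsto_const_nhds ?_
    filter_upwards [hF (Filter.eventually_ge_atTop X)] with A hA
    exact hm A X hA
  let g : (E → Bool) → Set E := fun s => {e | s e = true}
  have hg : Measurable g := by
    refine measurable_set_iff.2 fun a => ?_
    refine measurable_to_prop ?_
    have : (fun s : E → Bool => a ∈ g s) ⁻¹' {True} = (fun s => s a) ⁻¹' {true} := by
      ext; simp [g]
    rw [this]
    exact measurable_pi_apply a (measurableSet_singleton _)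
  refine ⟨(ν : Measure (E → Bool)).map g, Measure.isProbabilityMeasure_map hg.aemeasurable, ?_⟩
  intro A
  rw [map_measureReal_apply hg (measurableSet_superset A), ← hlim A]
  rfl

end Law

/-! ### The conditional probability bound -/

section Inequality

variable {𝕜 : Type*} [RCLike 𝕜] {F : Type*} [NormedAddCommGroup F] [InnerProductSpace 𝕜 F]

/-- If `w ∈ Hᗮ` vanishes at the indices outside `B`, then the ratio of the two determinants
(the conditional probability of `e`) is at most the squared norm of the part of `w` orthogonal to
all `v i`, relative to the squared modulus of the coordinate of `w` at `e`. -/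
theorem norm_sq_mul_det_le (H : Submodule 𝕜 F) [H.HasOrthogonalProjection]
    {n : Type*} [Fintype n] [DecidableEq n] {v : n → F} (hv : Orthonormal 𝕜 v)
    {Q : Matrix n n 𝕜} (hQ : ∀ i j, Q i j = inner 𝕜 (v i) (H.starProjection (v j)))
    {w : F} (hw : w ∈ Hᗮ) {B : Finset n} (hwB : ∀ i ∉ B, inner 𝕜 (v i) w = 0)
    {e : n} (he : e ∈ B) {r p : ℝ} (hr : (r : 𝕜) = (rowMix Q B Bᶜ).det)
    (hp : (p : 𝕜) = (rowMix Q (B.erase e) Bᶜ).det) :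
    ‖(inner 𝕜 (v e) w : 𝕜)‖ ^ 2 * (p * r) ≤
      p ^ 2 * ‖w - ∑ i, (inner 𝕜 (v i) w : 𝕜) • v i‖ ^ 2 := by
  set M := rowMix Q B Bᶜ
  set P := H.starProjection with hP
  -- This column of the adjugate solves `M u = r • 1_e` even if `M` is singular, and its `e`-th
  -- entry is `p`.
  set u : n → 𝕜 := fun i => M.adjugate i e with hu
  have hMu : ∀ i, ∑ j, M i j * u j = if i = e then (r : 𝕜) else 0 := by
    intro i
    have h := congr_fun (congr_fun M.mul_adjugate i) e
    rw [Matrix.mul_apply] at h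
    rw [hr, h]
    simp [Matrix.one_apply]
  have hue : u e = p := by
    rw [hp, hu]
    change M.adjugate e e = _
    rw [Matrix.adjugate_apply]
    congr 1
    ext i j
    by_cases hi : i = e
    · subst hi
      simp [rowMix, he, Matrix.one_apply, Pi.single_apply, eq_comm]
    · simp [M, rowMix, hi]
  set U := ∑ j, u j • v j with hU
  have hPU : ∀ i, inner 𝕜 (v i) (P U) = ∑ j, Q i j * u j := by
    intro i
    simp only [hU, map_sum, map_smul, inner_sum, inner_smul_right, hQ, mul_comm]
  have hPB : ∀ i ∈ B, inner 𝕜 (v i) (P U) = if i = e then (r : 𝕜) else 0 := by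
    intro i hi
    rw [hPU, ← hMu]
    simp [M, rowMix, hi]
  have hPC : ∀ i ∉ B, inner 𝕜 (v i) (P U) = u i := by
    intro i hi
    have h := hMu i
    have hie : i ≠ e := fun h => hi (h ▸ he)
    rw [if_neg hie] at h
    have h' : ∑ j, M i j * u j = u i - ∑ j, Q i j * u j := by
      simp [M, rowMix, hi, sub_mul, Finset.sum_sub_distrib, Matrix.one_apply]
    rw [hPU, eq_comm, ← sub_eq_zero, ← h', h]
  set a : 𝕜 := inner 𝕜 (v e) w with ha
  set T := w - ∑ i, (inner 𝕜 (v i) w : 𝕜) • v i with hT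
  -- `b` is supported on `B` and vanishes at `e` because `u e = p`. On `B` the vector `P U` has only
  -- its `e`-coordinate, so `b'` is orthogonal to `P U`.
  set b : n → 𝕜 := fun i => if i ∈ B then p * inner 𝕜 (v i) w - a * u i else 0 with hb
  set c : n → 𝕜 := fun i => if i ∈ B then 0 else a * u i with hc
  set b' := ∑ i, b i • v i with hb'
  set c' := ∑ i, c i • v i with hc'
  -- The projection of this vector is estimated from both sides: from below by dropping `P b'`, from
  -- above using `P w = 0`. The terms in `‖u i‖ ^ 2` with `i ∉ B` then cancel.
  have hz : a • U + b' = (p : 𝕜) • (w - T) + c' := by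
    have : w - T = ∑ i, (inner 𝕜 (v i) w : 𝕜) • v i := by rw [hT]; abel
    rw [this, hU, hb', hc', Finset.smul_sum, Finset.smul_sum, ← Finset.sum_add_distrib,
      ← Finset.sum_add_distrib]
    refine Finset.sum_congr rfl fun i _ => ?_
    simp only [smul_smul, ← add_smul]
    congr 1
    by_cases hi : i ∈ B
    · simp [hb, hc, hi]
    · simp [hb, hc, hi, hwB i hi]
  have hbU : inner 𝕜 b' (P U) = 0 := by
    rw [hb', sum_inner]
    refine Finset.sum_eq_zero fun i _ => ?_
    rw [inner_smul_left]
    by_cases hi : i ∈ B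
    · rw [hPB i hi]
      by_cases hie : i = e
      · subst hie
        simp [hb, hue, ha, mul_comm]
      · simp [hie]
    · simp [hb, hi]
  have hPP : ∀ x, P (P x) = P x := fun x =>
    Submodule.starProjection_eq_self_iff.2 (Submodule.starProjection_apply_mem _ _)
  have hlow : ‖a‖ ^ 2 * ‖P U‖ ^ 2 ≤ ‖P (a • U + b')‖ ^ 2 := by
    have h0 : inner 𝕜 (P b') (P U) = 0 := by
      rw [hP, Submodule.inner_starProjection_left_eq_right, ← hP, hPP, hbU]
    have h1 : inner 𝕜 (a • P U) (P b') = 0 := by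
      rw [inner_smul_left, ← inner_conj_symm, h0]; simp
    rw [map_add, map_smul, @norm_add_sq 𝕜, h1, norm_smul]
    simp only [map_zero]
    nlinarith [sq_nonneg ‖P b'‖]
  have hPw : P w = 0 := (Submodule.starProjection_apply_eq_zero_iff H).2 hw
  have hvT : ∀ i, inner 𝕜 (v i) T = 0 := by
    intro i
    rw [hT, inner_sub_right, hv.inner_right_fintype, sub_self]
  have hcT : inner 𝕜 c' ((p : 𝕜) • T) = 0 := by
    rw [hc', sum_inner]
    refine Finset.sum_eq_zero fun i _ => ?_
    rw [inner_smul_left, inner_smul_right, hvT]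
    simp
  have hup : ‖P (a • U + b')‖ ^ 2 ≤ ‖c'‖ ^ 2 + p ^ 2 * ‖T‖ ^ 2 := by
    have h1 : P (a • U + b') = P (c' - (p : 𝕜) • T) := by
      rw [hz, map_add, map_smul, map_sub P w T, hPw, map_sub P c', map_smul, zero_sub, smul_neg]
      abel
    have h2 : ‖c' - (p : 𝕜) • T‖ ^ 2 = ‖c'‖ ^ 2 + p ^ 2 * ‖T‖ ^ 2 := by
      rw [@norm_sub_sq 𝕜, hcT, norm_smul, mul_pow]
      simp
    rw [h1, ← h2]
    gcongr
    exact Submodule.norm_starProjection_apply_le _ _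
  have hPUn : ‖P U‖ ^ 2 = p * r + ∑ i, if i ∈ B then 0 else ‖u i‖ ^ 2 := by
    have h1 : (inner 𝕜 U (P U) : 𝕜) = ((p * r + ∑ i, if i ∈ B then 0 else ‖u i‖ ^ 2 : ℝ) : 𝕜) := by
      have h2 : ∀ i, (starRingEnd 𝕜) (u i) * inner 𝕜 (v i) (P U) =
          (if i = e then ((p * r : ℝ) : 𝕜) else 0) +
            ((if i ∈ B then 0 else ‖u i‖ ^ 2 : ℝ) : 𝕜) := by
        intro i
        by_cases hi : i ∈ B
        · rw [hPB i hi, if_pos hi]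
          by_cases hie : i = e
          · subst hie
            simp [hue]
          · simp [hie]
        · have hie : i ≠ e := fun h => hi (h ▸ he)
          rw [hPC i hi, if_neg hi, if_neg hie, RCLike.conj_mul]
          simp
      have h3 : ∀ x, inner 𝕜 U x = ∑ i, (starRingEnd 𝕜) (u i) * inner 𝕜 (v i) x := by
        intro x
        rw [hU, sum_inner]
        simp only [inner_smul_left]
      simp only [h3, h2, Finset.sum_add_distrib]
      simp
    rw [← inner_self_eq_norm_sq (𝕜 := 𝕜), hP, Submodule.inner_starProjection_left_eq_right,
      ← hP, hPP, h1, RCLike.ofReal_re]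
  have hcn : ‖c'‖ ^ 2 = ‖a‖ ^ 2 * ∑ i, if i ∈ B then 0 else ‖u i‖ ^ 2 := by
    have h1 : (inner 𝕜 c' c' : 𝕜) =
        ((‖a‖ ^ 2 * ∑ i, if i ∈ B then 0 else ‖u i‖ ^ 2 : ℝ) : 𝕜) := by
      rw [hc', hv.inner_sum, Finset.mul_sum]
      push_cast
      refine Finset.sum_congr rfl fun i _ => ?_
      rw [RCLike.conj_mul]
      by_cases hi : i ∈ B
      · simp [hc, hi]
      · simp [hc, hi, mul_pow]
    rw [← inner_self_eq_norm_sq (𝕜 := 𝕜), h1, RCLike.ofReal_re]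
  have := hlow.trans hup
  rw [hPUn, hcn] at this
  linarith

/-- The matrix of a compressed orthogonal projection is positive semidefinite. -/
theorem posSemidef_inner_starProjection (H : Submodule 𝕜 F) [H.HasOrthogonalProjection]
    {n : Type*} [Fintype n] (v : n → F) :
    open scoped ComplexOrder in
    (Matrix.of fun i j => inner 𝕜 (v i) (H.starProjection (v j))).PosSemidef := by
  have : (Matrix.of fun i j => inner 𝕜 (v i) (H.starProjection (v j))) =
      Matrix.gram 𝕜 fun i => H.starProjection (v i) := by
    ext i j
    rw [Matrix.gram_apply, Matrix.of_apply, Submodule.inner_starProjection_left_eq_right,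
      Submodule.starProjection_eq_self_iff.2 (Submodule.starProjection_apply_mem _ _)]
  rw [this]
  exact Matrix.posSemidef_gram 𝕜 _

end Inequality

/-! ### Coordinates in `ℓ²(E)` and the duality criterion -/

section Coordinates

variable {𝕜 : Type*} [RCLike 𝕜] {E : Type*} [DecidableEq E]

theorem inner_basisVec (e : E) (f : ell2 𝕜 E) : inner 𝕜 (basisVec 𝕜 e) f = f e := by
  rw [basisVec, lp.inner_single_left]
  simp

theorem orthonormal_basisVec : Orthonormal 𝕜 (basisVec 𝕜 : E → ell2 𝕜 E) := by
  rw [orthonormal_iff_ite]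
  intro i j
  rw [inner_basisVec, basisVec, lp.coeFn_single, Pi.single_apply]

theorem hasSum_inner_basisVec_smul (f : ell2 𝕜 E) :
    HasSum (fun e => (inner 𝕜 (basisVec 𝕜 e) f : 𝕜) • basisVec 𝕜 e) f := by
  have h := lp.hasSum_single (p := 2) (by simp) f
  convert h using 2 with e
  rw [inner_basisVec, basisVec, ← lp.single_smul, smul_eq_mul, mul_one]

theorem inner_basisVec_eq_zero_of_mem_bracket {S : Set E} {w : ell2 𝕜 E}
    (hw : w ∈ bracket 𝕜 S) {e : E} (he : e ∉ S) : inner 𝕜 (basisVec 𝕜 e) w = 0 := by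
  have h : bracket 𝕜 S ≤ (Submodule.span 𝕜 {basisVec 𝕜 e})ᗮ := by
    refine Submodule.topologicalClosure_minimal _ (Submodule.span_le.2 ?_)
      (Submodule.isClosed_orthogonal _)
    rintro _ ⟨f, hf, rfl⟩
    have hef : e ≠ f := fun h => he (h ▸ hf)
    exact (Submodule.mem_orthogonal_singleton_iff_inner_right).2
      (orthonormal_basisVec.2 hef)
  exact Submodule.mem_orthogonal_singleton_iff_inner_right.1 (h hw)

/-- The orthogonal complement of `P_[S] H` inside `[S]` is `Hᗮ ∩ [S]`, by self-adjointness of the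
projection. -/
theorem restrictTo_eq_bracket {H : Submodule 𝕜 (ell2 𝕜 E)} {S : Set E}
    (h : ∀ w ∈ Hᗮ, w ∈ bracket 𝕜 S → w = 0) : restrictTo H S = bracket 𝕜 S := by
  have hle : restrictTo H S ≤ bracket 𝕜 S := by
    refine Submodule.topologicalClosure_minimal _ ?_ (Submodule.isClosed_topologicalClosure _)
    rintro _ ⟨x, -, rfl⟩
    exact Submodule.starProjection_apply_mem _ _
  have hc : CompleteSpace (restrictTo H S) :=
    (Submodule.isClosed_topologicalClosure _).completeSpace_coe
  have hbot : (restrictTo H S)ᗮ ⊓ bracket 𝕜 S = ⊥ := by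
    rw [eq_bot_iff]
    rintro w ⟨hw, hwS⟩
    refine (Submodule.mem_bot 𝕜).2 (h w (fun x hx => ?_) hwS)
    have h1 := hw ((bracket 𝕜 S).starProjection x)
      (Submodule.le_topologicalClosure _ ⟨x, hx, rfl⟩)
    rwa [Submodule.inner_starProjection_left_eq_right,
      Submodule.starProjection_eq_self_iff.2 hwS] at h1
  have := Submodule.sup_orthogonal_inf_of_hasOrthogonalProjection hle
  rwa [hbot, sup_bot_eq] at this

open scoped ComplexOrder in
theorem posSemidef_projMatrix (H : ClosedSubmodule 𝕜 (ell2 𝕜 E)) (A : Finset E) :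
    ((projMatrix H).submatrix (fun i : A => (i : E)) (fun i : A => (i : E))).PosSemidef :=
  posSemidef_inner_starProjection H.toSubmodule fun i : A => basisVec 𝕜 (i : E)

open scoped ComplexOrder in
theorem posSemidef_one_sub_projMatrix (H : ClosedSubmodule 𝕜 (ell2 𝕜 E)) (A : Finset E) :
    (1 - (projMatrix H).submatrix (fun i : A => (i : E)) (fun i : A => (i : E))).PosSemidef := by
  convert posSemidef_inner_starProjection H.toSubmoduleᗮ fun i : A => basisVec 𝕜 (i : E) using 1
  ext i j
  rw [Matrix.of_apply, Submodule.starProjection_orthogonal_val, inner_sub_right,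
    orthonormal_iff_ite.1 orthonormal_basisVec]
  simp [projMatrix, Matrix.one_apply]

end Coordinates

/-! ### Almost sure triviality of `Hᗮ ∩ [S]` -/

section AlmostSure

variable {𝕜 : Type*} [RCLike 𝕜] {E : Type*} [DecidableEq E]

theorem measure_setOf_eventually_mem_le {Ω : Type*} [MeasurableSpace Ω] {μ : Measure Ω}
    {D : ℕ → Set Ω} {c : ENNReal} (h : ∀ n, μ (D n) ≤ c) :
    μ {x | ∀ᶠ n in Filter.atTop, x ∈ D n} ≤ c := by
  have : {x | ∀ᶠ n in Filter.atTop, x ∈ D n} = ⋃ N, ⋂ n ≥ N, D n := by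
    ext x; simp [Filter.eventually_atTop]
  rw [this, Monotone.measure_iUnion]
  · exact iSup_le fun N => (measure_mono (Set.biInter_subset_of_mem (le_refl N))).trans (h N)
  · exact fun N M hNM => Set.biInter_subset_biInter_left fun n hn => le_trans hNM hn

/-- The sets containing `e` whose trace on `A` makes `e` improbable, given their trace on
`A \ {e}`. -/
def improbable (μ : Measure (Set E)) (e : E) (δ : ℝ) (A : Finset E) : Set (Set E) :=
  {S | ∃ he : e ∈ A, ∃ B : Finset A, ⟨e, he⟩ ∈ B ∧ S ∈ pattern A B Bᶜ ∧
    μ.real (pattern A B Bᶜ) ≤ δ * μ.real (pattern A (B.erase ⟨e, he⟩) Bᶜ)}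

theorem measure_improbable_le (μ : Measure (Set E)) [IsProbabilityMeasure μ] (e : E) {δ : ℝ}
    (hδ : 0 ≤ δ) (A : Finset E) : μ (improbable μ e δ A) ≤ ENNReal.ofReal δ := by
  classical
  by_cases he : e ∈ A
  swap
  · have : improbable μ e δ A = ∅ := by
      ext S; simp [improbable, he]
    simp [this]
  let G : Finset (Finset A) := Finset.univ.filter fun B => ⟨e, he⟩ ∈ B ∧
    μ.real (pattern A B Bᶜ) ≤ δ * μ.real (pattern A (B.erase ⟨e, he⟩) Bᶜ)
  have hsub : improbable μ e δ A ⊆ ⋃ B ∈ G, pattern A B Bᶜ := by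
    rintro S ⟨_, B, h1, h2, h3⟩
    exact Set.mem_biUnion (x := B) (by simp [G, h1, h3]) h2
  -- All `B` in `G` contain `e`, so erasing it loses no information: these are distinct traces on `A
  -- \ {e}`.
  have hdisj : Set.PairwiseDisjoint (G : Set (Finset A))
      fun B => pattern A (B.erase ⟨e, he⟩) Bᶜ := by
    intro B hB C hC hBC
    refine Set.disjoint_left.2 fun S h h' => hBC ?_
    have hB := (Finset.mem_filter.1 hB).2.1
    have hC := (Finset.mem_filter.1 hC).2.1
    ext i
    by_cases hi : i = ⟨e, he⟩
    · simp [hi, hB, hC]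
    · constructor
      · intro hiB
        by_contra hiC
        exact h'.2 i (by simpa using hiC) (h.1 i (Finset.mem_erase.2 ⟨hi, hiB⟩))
      · intro hiC
        by_contra hiB
        exact h.2 i (by simpa using hiB) (h'.1 i (Finset.mem_erase.2 ⟨hi, hiC⟩))
  have hle : μ.real (⋃ B ∈ G, pattern A B Bᶜ) ≤ δ := by
    calc μ.real (⋃ B ∈ G, pattern A B Bᶜ)
        ≤ ∑ B ∈ G, μ.real (pattern A B Bᶜ) := measureReal_biUnion_finset_le _ _
      _ ≤ ∑ B ∈ G, δ * μ.real (pattern A (B.erase ⟨e, he⟩) Bᶜ) :=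
          Finset.sum_le_sum fun B hB => (Finset.mem_filter.1 hB).2.2
      _ = δ * μ.real (⋃ B ∈ G, pattern A (B.erase ⟨e, he⟩) Bᶜ) := by
          rw [← Finset.mul_sum, measureReal_biUnion_finset hdisj
            fun B _ => measurableSet_pattern _ _ _]
      _ ≤ δ * 1 := by gcongr; exact measureReal_le_one
      _ = δ := mul_one δ
  refine (measure_mono hsub).trans ?_
  rw [← ofReal_measureReal (measure_ne_top _ _)]
  exact ENNReal.ofReal_le_ofReal hle

theorem eventually_mem_improbable {H : ClosedSubmodule 𝕜 (ell2 𝕜 E)} {μ : Measure (Set E)}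
    (hμ : IsDeterminantal (projMatrix H) μ) {e : E} {δ : ℝ} (hδ : 0 < δ) {S : Set E}
    {w : ell2 𝕜 E} (hw : w ∈ H.toSubmoduleᗮ) (hwS : w ∈ bracket 𝕜 S)
    (hwe : inner 𝕜 (basisVec 𝕜 e) w ≠ 0) :
    ∀ᶠ A in Filter.atTop, S ∈ improbable μ e δ A := by
  classical
  have := hμ.isProbabilityMeasure
  have heS : e ∈ S := by
    by_contra h
    exact hwe (inner_basisVec_eq_zero_of_mem_bracket hwS h)
  have hpos : 0 < ‖(inner 𝕜 (basisVec 𝕜 e) w : 𝕜)‖ ^ 2 := by positivity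
  have hlim : Filter.Tendsto
      (fun A : Finset E => ‖w - ∑ i ∈ A, (inner 𝕜 (basisVec 𝕜 i) w : 𝕜) • basisVec 𝕜 i‖ ^ 2)
      Filter.atTop (nhds 0) := by
    have h := (tendsto_const_nhds (x := w)).sub (hasSum_inner_basisVec_smul w)
    simpa using h.norm.pow 2
  filter_upwards [hlim.eventually (gt_mem_nhds (mul_pos hδ hpos)),
    Filter.eventually_ge_atTop {e}] with A hA heA
  have he : e ∈ A := heA (Finset.mem_singleton_self e)
  let B : Finset A := Finset.univ.filter fun i => (i : E) ∈ S
  have heB : ⟨e, he⟩ ∈ B := by simp [B, heS]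
  refine ⟨he, B, heB, ⟨fun i hi => by simpa [B] using hi, fun i hi => by simpa [B] using hi⟩, ?_⟩
  have hr := hμ.measureReal_pattern A B Bᶜ disjoint_compl_right
  have hp := hμ.measureReal_pattern A (B.erase ⟨e, he⟩) Bᶜ
    (disjoint_compl_right.mono_left (Finset.erase_subset _ _))
  have hsub : μ.real (pattern A B Bᶜ) ≤ μ.real (pattern A (B.erase ⟨e, he⟩) Bᶜ) :=
    measureReal_mono fun S hS => ⟨fun i hi => hS.1 i (Finset.mem_of_mem_erase hi), hS.2⟩
  have hineq := norm_sq_mul_det_le H.toSubmodule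
    (orthonormal_basisVec.comp (fun i : A => (i : E)) Subtype.val_injective)
    (Q := (projMatrix H).submatrix (fun i : A => (i : E)) (fun i : A => (i : E)))
    (fun i j => rfl) hw (B := B)
    (fun i hi => inner_basisVec_eq_zero_of_mem_bracket hwS (by simpa [B] using hi)) heB hr hp
  set r := μ.real (pattern A B Bᶜ)
  set p := μ.real (pattern A (B.erase ⟨e, he⟩) Bᶜ)
  have hp0 : 0 ≤ p := measureReal_nonneg
  -- If `p = 0` the determinant inequality is empty, but `r ≤ p` suffices.
  rcases hp0.eq_or_lt with h0 | h0
  · rw [← h0] at hsub ⊢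
    simpa using hsub
  have hsum : ∑ i : A, (inner 𝕜 (basisVec 𝕜 (i : E)) w : 𝕜) • basisVec 𝕜 (i : E) =
      ∑ i ∈ A, (inner 𝕜 (basisVec 𝕜 i) w : 𝕜) • basisVec 𝕜 i :=
    Finset.sum_coe_sort A fun i => (inner 𝕜 (basisVec 𝕜 i) w : 𝕜) • basisVec 𝕜 i
  simp only [Function.comp_apply] at hineq
  rw [hsum] at hineq
  set a := ‖(inner 𝕜 (basisVec 𝕜 e) w : 𝕜)‖ ^ 2
  have h1 : a * (p * r) ≤ p ^ 2 * (δ * a) :=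
    hineq.trans (mul_le_mul_of_nonneg_left hA.le (sq_nonneg p))
  have h2 : (a * p) * r ≤ (a * p) * (δ * p) := by linarith
  exact le_of_mul_le_mul_left h2 (mul_pos hpos h0)

theorem ae_forall_mem_orthogonal_bracket_eq_zero [Countable E] {H : ClosedSubmodule 𝕜 (ell2 𝕜 E)}
    {μ : Measure (Set E)} (hμ : IsDeterminantal (projMatrix H) μ) :
    ∀ᵐ S ∂μ, ∀ w ∈ H.toSubmoduleᗮ, w ∈ bracket 𝕜 S → w = 0 := by
  have := hμ.isProbabilityMeasure
  -- Countability of `E` gives a cofinal sequence of finite sets, so that continuity from below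
  -- applies.
  obtain ⟨A, hA⟩ := Filter.exists_seq_tendsto (Filter.atTop : Filter (Finset E))
  have hnull : ∀ e : E, ∀ᵐ S ∂μ, ∀ w ∈ H.toSubmoduleᗮ, w ∈ bracket 𝕜 S →
      inner 𝕜 (basisVec 𝕜 e) w = 0 := by
    intro e
    refine le_antisymm (ENNReal.le_of_forall_pos_le_add fun δ hδ _ => ?_) zero_le
    rw [zero_add]
    have h := measure_setOf_eventually_mem_le (μ := μ)
      fun n => measure_improbable_le μ e δ.coe_nonneg (A n)
    rw [ENNReal.ofReal_coe_nnreal] at h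
    -- Only monotonicity is used, so the set of bad `S` need not be shown measurable.
    refine (measure_mono fun S hS => ?_).trans h
    simp only [Set.mem_compl_iff, Set.mem_ofPred_eq, not_forall] at hS
    obtain ⟨w, hw, hwS, hwe⟩ := hS
    exact hA.eventually (eventually_mem_improbable hμ (NNReal.coe_pos.2 hδ) hw hwS hwe)
  filter_upwards [ae_all_iff.2 hnull] with S hS w hw hwS
  ext e
  rw [← inner_basisVec, hS e w hw hwS]
  rfl

end AlmostSure

end Determinantal

theorem mainTheorem2 {𝕜 : Type*} [RCLike 𝕜] {E : Type*} [Countable E] [DecidableEq E]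
    (H : ClosedSubmodule 𝕜 (Determinantal.ell2 𝕜 E)) :
    (∃! μ : MeasureTheory.Measure (Set E),
      Determinantal.IsDeterminantal (Determinantal.projMatrix H) μ) ∧
    ∀ μ : MeasureTheory.Measure (Set E),
      Determinantal.IsDeterminantal (Determinantal.projMatrix H) μ →
      ∀ᵐ S ∂μ, Determinantal.restrictTo H.toSubmodule S = Determinantal.bracket 𝕜 S := by
  obtain ⟨μ, hμ⟩ := Determinantal.exists_isDeterminantal
    (Determinantal.posSemidef_projMatrix H) (Determinantal.posSemidef_one_sub_projMatrix H)
  refine ⟨⟨μ, hμ, fun ν hν => hν.unique hμ⟩, fun ν hν => ?_⟩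
  filter_upwards [Determinantal.ae_forall_mem_orthogonal_bracket_eq_zero hν] with S hS
  exact Determinantal.restrictTo_eq_bracket hS
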